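/- \textbf{Definitions.} A Kleene algebra $K$, with natural order $a\le b\iff a+b=b$, is \emph{$*$-continuous} if $a\,c^*\,b=\sup_{n\ge 0} a\,c^n\,b$ for all $a,b,c\in K$. For a monoid $M$, let $\mathcal R M$ be the $*$-continuous Kleene algebra of regular subsets of $M$, i.e. the least family of subsets of $M$ that contains the finite sets and is closed under union, elementwise product and $A\mapsto A^*=\bigcup_{n\ge0}A^n$. For a $*$-continuous Kleene algebra $D$, $\mathcal R D$ denotes the regular subsets of its multiplicative monoid; each $A\in\mathcal R D$ has a least upper bound $\sum A\in D$. An \emph{$\mathcal R$-congruence} on $D$ is a semiring congruence $\rho$ such that, for $U,U'\in\mathcal R D$, if the sets $\{d/\rho : d\in U\}$ and $\{d/\rho : d\in U'\}$ generate the same down-set of $D/\rho$, then $(\sum U)/\rho=(\sum U')/\rho$. The quotient of $D$ by an $\mathcal R$-congruence is again a $*$-continuous Kleene algebra. Let $\Delta_2=\{b,p\}\cup\{d,q\}$ be an alphabet of two opening brackets $b=p_0$, $p=p_1$ and two closing brackets $d=q_0$, $q=q_1$. The \emph{polycyclic Kleene algebra} $C_2'$ is the quotient of $\mathcal R\Delta_2^*$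 by the least $\mathcal R$-congruence with $p_iq_j=\delta_{i,j}$ for $i,j\in\{0,1\}$. The \emph{tensor product} $K_1\otimes_{\mathcal R}K_2$ of $*$-continuous Kleene algebras is the quotient of $\mathcal R(K_1\times K_2)$, where $K_1\times K_2$ is the product of the multiplicative monoids, by the least $\mathcal R$-congruence identifying $A\times B$ with $\{(\sum A,\sum B)\}$ for all $A\in\mathcal R K_1$, $B\in\mathcal R K_2$. Elements $k\in K_1$ and $c\in K_2$ are also written for their images in $K_1\otimes_{\mathcal R}K_2$, the classes of $\{(k,1)\}$ and $\{(1,c)\}$. For $n\ge1$, the iteration $M^*$ of an $n\times n$ matrix over a Kleene algebra is defined by induction on $n$: $(k)^*=(k^*)$ for $n=1$, and for $n>1$ \[ \begin{pmatrix}A&B\\ C&D\end{pmatrix}^*=\begin{pmatrix}G^*&G^*BD^*\\ D^*CG^*&D^*CG^*BD^*+D^*\end{pmatrix},\qquad G=A+BD^*C, \] for any splitting with square blocks $A$, $D$ of dimensions less than $n$ (the result does not depend on the splitting). \textbf{Theorem.} Let $K$ be a $*$-continuous Kleene algebra. For each $\varphi\in K\otimes_{\mathcal R}C_2'$ there are an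 integer $n\ge1$, $S\in\{0,1\}^{1\times n}$, $F\in\{0,1\}^{n\times1}$, $U\in\{0,b,p\}^{n\times n}$, $V\in\{0,d,q\}^{n\times n}$ and $X\in K^{n\times n}$ such that \[ \varphi=S\,(U+X+V)^*F \] in $K\otimes_{\mathcal R}C_2'$. -/

import Mathlib

/-! ## Star-continuous Kleene algebras and regular subsets of monoids -/

/-- A Kleene algebra is star-continuous if `a * c∗ * b` is the least upper bound of the
elements `a * c ^ n * b`, for all `a`, `b`, `c`. -/
class StarContinuous (K : Type*) [KleeneAlgebra K] : Prop where
  isLUB_mul_kstar_mul : ∀ a c b : K,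
    IsLUB (Set.range fun n : ℕ => a * c ^ n * b) (a * KStar.kstar c * b)

section RegularSets

open scoped Pointwise

/-- The regular (rational) subsets of a monoid: the least family of subsets that contains the
finite sets and is closed under union, elementwise product and iteration `A ↦ ⋃ n, A ^ n`. -/
inductive IsRegSet {M : Type*} [Monoid M] : Set M → Prop
  | empty : IsRegSet ∅
  | singleton (m : M) : IsRegSet {m}
  | union {A B : Set M} : IsRegSet A → IsRegSet B → IsRegSet (A ∪ B)
  | mul {A B : Set M} : IsRegSet A → IsRegSet B → IsRegSet (A * B)
  | star {A : Set M} : IsRegSet A → IsRegSet (⋃ n : ℕ, A ^ n)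

/-- The type of regular subsets of a monoid `M`. -/
def RegSet (M : Type*) [Monoid M] : Type _ := {A : Set M // IsRegSet A}

/-- An idempotent semiring with a star operation that satisfies the star-continuity condition
is a Kleene algebra. -/
abbrev kleeneAlgebraOfStarContinuous {K : Type*} [IdemSemiring K] (star : K → K)
    (h : ∀ a c b : K, IsLUB (Set.range fun n : ℕ => a * c ^ n * b) (a * star c * b)) :
    KleeneAlgebra K where
  kstar := star
  one_le_kstar a := by
    have := (h 1 a 1).1 ⟨0, rfl⟩
    simpa using this
  mul_kstar_le_kstar a := by
    have h1 := (h a a 1).2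
    have h2 := (h 1 a 1).1
    simp only [mul_one, one_mul] at h1 h2
    apply h1
    rintro _ ⟨n, rfl⟩
    exact h2 ⟨n + 1, by simp [pow_succ']⟩
  kstar_mul_le_kstar a := by
    have h1 := (h 1 a a).2
    have h2 := (h 1 a 1).1
    simp only [mul_one, one_mul] at h1 h2
    apply h1
    rintro _ ⟨n, rfl⟩
    exact h2 ⟨n + 1, by simp [pow_succ]⟩
  mul_kstar_le_self a b hab := by
    have h1 := (h b a 1).2
    simp only [mul_one] at h1
    apply h1
    rintro _ ⟨n, rfl⟩
    induction n with
    | zero => simp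
    | succ n ih =>
      refine le_trans ?_ hab
      simp only [pow_succ, ← mul_assoc]
      exact mul_le_mul_left ih a
  kstar_mul_le_self a b hab := by
    have h1 := (h 1 a b).2
    simp only [one_mul] at h1
    apply h1
    rintro _ ⟨n, rfl⟩
    induction n with
    | zero => simp
    | succ n ih =>
      refine le_trans ?_ hab
      simp only [pow_succ', mul_assoc]
      exact mul_le_mul_right ih a

namespace RegSet

variable {M : Type*} [Monoid M]

/-- The regular set `{m}`. -/
def single (m : M) : RegSet M := ⟨{m}, IsRegSet.singleton m⟩

instance instAdd : Add (RegSet M) := ⟨fun A B => ⟨A.1 ∪ B.1, A.2.union B.2⟩⟩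

instance instMul : Mul (RegSet M) := ⟨fun A B => ⟨A.1 * B.1, A.2.mul B.2⟩⟩

instance instZero : Zero (RegSet M) := ⟨⟨∅, IsRegSet.empty⟩⟩

instance instOne : One (RegSet M) := ⟨⟨{1}, IsRegSet.singleton 1⟩⟩

/-- `RegSet M` is a semiring: addition is union, multiplication is the elementwise product,
`0 = ∅` and `1 = {1}`. -/
instance instSemiring : Semiring (RegSet M) where
  add_assoc A B C := Subtype.ext (Set.union_assoc A.1 B.1 C.1)
  zero_add A := Subtype.ext (Set.empty_union A.1)
  add_zero A := Subtype.ext (Set.union_empty A.1)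
  add_comm A B := Subtype.ext (Set.union_comm A.1 B.1)
  mul_assoc A B C := Subtype.ext (mul_assoc A.1 B.1 C.1)
  one_mul A := Subtype.ext (one_mul A.1)
  mul_one A := Subtype.ext (mul_one A.1)
  zero_mul A := Subtype.ext (Set.empty_mul (s := A.1))
  mul_zero A := Subtype.ext (Set.mul_empty (s := A.1))
  left_distrib A B C := Subtype.ext (Set.mul_union (s := A.1) (t₁ := B.1) (t₂ := C.1))
  right_distrib A B C := Subtype.ext (Set.union_mul (s₁ := A.1) (s₂ := B.1) (t := C.1))
  nsmul := nsmulRec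
  npow := npowRec

instance instIdemSemiring : IdemSemiring (RegSet M) :=
  IdemSemiring.ofSemiring fun A => Subtype.ext (Set.union_self A.1)

theorem le_iff {A B : RegSet M} : A ≤ B ↔ A.1 ⊆ B.1 := by
  rw [← Set.union_eq_right]
  exact Subtype.ext_iff

theorem val_mul (A B : RegSet M) : (A * B).1 = A.1 * B.1 := rfl

theorem val_add (A B : RegSet M) : (A + B).1 = A.1 ∪ B.1 := rfl

theorem val_pow (A : RegSet M) (n : ℕ) : (A ^ n).1 = A.1 ^ n := by
  induction n with
  | zero => rw [pow_zero, pow_zero]; rfl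
  | succ n ih => rw [pow_succ, pow_succ, val_mul, ih]

/-- The iteration `A ↦ ⋃ n, A ^ n` of regular sets. -/
def iter (A : RegSet M) : RegSet M := ⟨⋃ n : ℕ, A.1 ^ n, A.2.star⟩

theorem val_iter (A : RegSet M) : A.iter.1 = ⋃ n : ℕ, A.1 ^ n := rfl

theorem isLUB_iter (A C B : RegSet M) :
    IsLUB (Set.range fun n : ℕ => A * C ^ n * B)
      (A * C.iter * B) := by
  constructor
  · rintro _ ⟨n, rfl⟩
    rw [le_iff]
    simp only [val_mul, val_pow, val_iter]
    exact Set.mul_subset_mul_right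
      (Set.mul_subset_mul_left (Set.subset_iUnion (fun n : ℕ => C.1 ^ n) n))
  · intro E hE
    rw [le_iff]
    simp only [val_mul, val_iter, Set.mul_iUnion, Set.iUnion_mul]
    refine Set.iUnion_subset fun n => ?_
    have h := hE ⟨n, rfl⟩
    rw [le_iff] at h
    simpa only [val_mul, val_pow] using h

/-- The regular subsets of a monoid form a Kleene algebra, with star `A ↦ ⋃ n, A ^ n`. -/
instance instKleeneAlgebra : KleeneAlgebra (RegSet M) :=
  kleeneAlgebraOfStarContinuous iter isLUB_iter

instance instStarContinuous : StarContinuous (RegSet M) := ⟨isLUB_iter⟩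

end RegSet

/-- The image of a regular set under a monoid homomorphism is regular. -/
theorem IsRegSet.image {M N : Type*} [Monoid M] [Monoid N] (f : M →* N) {A : Set M}
    (hA : IsRegSet A) : IsRegSet (f '' A) := by
  induction hA with
  | empty => simpa using IsRegSet.empty
  | singleton m => simpa using IsRegSet.singleton (f m)
  | union _ _ h1 h2 => rw [Set.image_union]; exact h1.union h2
  | mul _ _ h1 h2 => rw [Set.image_mul]; exact h1.mul h2
  | star _ h =>
    rw [Set.image_iUnion]
    simp only [Set.image_pow]
    exact h.star

/-- A product `A × B` of regular sets is a regular subset of the product monoid. -/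
theorem IsRegSet.prod {M N : Type*} [Monoid M] [Monoid N] {A : Set M} {B : Set N}
    (hA : IsRegSet A) (hB : IsRegSet B) : IsRegSet (A ×ˢ B) := by
  have h := (hA.image (MonoidHom.inl M N)).mul (hB.image (MonoidHom.inr M N))
  convert h using 1
  ext ⟨a, b⟩
  simp [Set.mem_mul]

/-- In a star-continuous Kleene algebra, every regular set has a least upper bound, and
multiplication distributes over it. -/
theorem IsRegSet.exists_isLUB {K : Type*} [KleeneAlgebra K] [StarContinuous K] {U : Set K}
    (hU : IsRegSet U) : ∃ u : K, ∀ a b : K, IsLUB ((fun x => a * x * b) '' U) (a * u * b) := by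
  have hmul : ∀ {U V : Set K} {u v : K},
      (∀ a b : K, IsLUB ((fun x => a * x * b) '' U) (a * u * b)) →
      (∀ a b : K, IsLUB ((fun x => a * x * b) '' V) (a * v * b)) →
      ∀ a b : K, IsLUB ((fun x => a * x * b) '' (U * V)) (a * (u * v) * b) := by
    intro U V u v hu hv a b
    constructor
    · rintro _ ⟨_, ⟨x, hx, y, hy, rfl⟩, rfl⟩
      have h1 : a * x * (y * b) ≤ a * u * (y * b) := (hu a (y * b)).1 ⟨x, hx, rfl⟩
      have h2 : a * u * y * b ≤ a * u * v * b := (hv (a * u) b).1 ⟨y, hy, rfl⟩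
      simp only [mul_assoc] at h1 h2 ⊢
      exact h1.trans h2
    · intro e he
      have h : a * u * v * b ≤ e := by
        refine (hv (a * u) b).2 ?_
        rintro _ ⟨y, hy, rfl⟩
        have : a * u * (y * b) ≤ e := by
          refine (hu a (y * b)).2 ?_
          rintro _ ⟨x, hx, rfl⟩
          have := he ⟨x * y, ⟨x, hx, y, hy, rfl⟩, rfl⟩
          simpa only [mul_assoc] using this
        simpa only [mul_assoc] using this
      simpa only [mul_assoc] using h
  induction hU with
  | empty => exact ⟨0, fun a b => by simpa using (bot_le : (⊥ : K) ≤ 0).antisymm' zero_le⟩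
  | singleton m => exact ⟨m, fun a b => by simp⟩
  | union _ _ h1 h2 =>
    obtain ⟨u, hu⟩ := h1
    obtain ⟨v, hv⟩ := h2
    refine ⟨u + v, fun a b => ?_⟩
    rw [Set.image_union, mul_add, add_mul, add_eq_sup]
    exact (hu a b).union (hv a b)
  | mul _ _ h1 h2 =>
    obtain ⟨u, hu⟩ := h1
    obtain ⟨v, hv⟩ := h2
    exact ⟨u * v, hmul hu hv⟩
  | @star U _ h =>
    obtain ⟨u, hu⟩ := h
    have hpow : ∀ n : ℕ, ∀ a b : K,
        IsLUB ((fun x => a * x * b) '' (U ^ n)) (a * u ^ n * b) := by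
      intro n
      induction n with
      | zero => intro a b; simp
      | succ n ih => rw [pow_succ, pow_succ]; exact hmul ih hu
    refine ⟨KStar.kstar u, fun a b => ?_⟩
    have hs := StarContinuous.isLUB_mul_kstar_mul a u b
    constructor
    · rintro _ ⟨x, hx, rfl⟩
      obtain ⟨n, hn⟩ := Set.mem_iUnion.1 hx
      exact ((hpow n a b).1 ⟨x, hn, rfl⟩).trans (hs.1 ⟨n, rfl⟩)
    · intro e he
      refine hs.2 ?_
      rintro _ ⟨n, rfl⟩
      refine (hpow n a b).2 ?_
      rintro _ ⟨x, hx, rfl⟩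
      exact he ⟨x, Set.mem_iUnion.2 ⟨n, hx⟩, rfl⟩

end RegularSets

/-! ## Congruences and quotients -/

section Congruences

open scoped Pointwise

variable {D : Type*}

/-- The down-set in the quotient `D/ρ` generated by the classes of the elements of `U`, for the
natural order of `D/ρ` (`x ≤ y` iff `x + y = y`). -/
def quotDownset [Semiring D] (ρ : RingCon D) (U : Set D) : Set ρ.Quotient :=
  {x | ∃ d ∈ U, x + (d : ρ.Quotient) = (d : ρ.Quotient)}

/-- A semiring congruence `ρ` is regular if the suprema of regular sets `U`, `U'` are
`ρ`-congruent whenever the classes of `U` and of `U'` generate the same down-set of `D/ρ`. -/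
def IsRegCongruence [KleeneAlgebra D] (ρ : RingCon D) : Prop :=
  ∀ U U' : Set D, IsRegSet U → IsRegSet U' → ∀ u u' : D, IsLUB U u → IsLUB U' u' →
    quotDownset ρ U = quotDownset ρ U' → ρ u u'

/-- The least regular congruence containing a relation `R`. -/
def regCongruenceGen [KleeneAlgebra D] (R : D → D → Prop) : RingCon D :=
  sInf {ρ : RingCon D | IsRegCongruence ρ ∧ ∀ x y, R x y → ρ x y}

theorem regCongruenceGen_iff [KleeneAlgebra D] {R : D → D → Prop} {x y : D} :
    regCongruenceGen R x y ↔
      ∀ ρ : RingCon D, IsRegCongruence ρ → (∀ x y, R x y → ρ x y) → ρ x y := by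
  change (∀ ρ ∈ {ρ : RingCon D | IsRegCongruence ρ ∧ ∀ x y, R x y → ρ x y}, ρ x y) ↔ _
  simp only [Set.mem_ofPred_eq, and_imp]

theorem isRegCongruence_regCongruenceGen [KleeneAlgebra D] (R : D → D → Prop) :
    IsRegCongruence (regCongruenceGen R) := by
  have key : ∀ (ρ : RingCon D), IsRegCongruence ρ → (∀ x y, R x y → ρ x y) →
      ∀ U U' : Set D, quotDownset (regCongruenceGen R) U ⊆ quotDownset (regCongruenceGen R) U' →
        quotDownset ρ U ⊆ quotDownset ρ U' := by
    intro ρ h1 h2 U U' hUU' x hx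
    obtain ⟨d, hd, hxd⟩ := hx
    have hd' : (d : (regCongruenceGen R).Quotient) ∈ quotDownset (regCongruenceGen R) U :=
      ⟨d, hd, by rw [← RingCon.coe_add, add_idem]⟩
    obtain ⟨d', hd', hdd'⟩ := hUU' hd'
    refine ⟨d', hd', ?_⟩
    rw [← RingCon.coe_add, RingCon.eq, regCongruenceGen_iff] at hdd'
    have h3 : (d : ρ.Quotient) + (d' : ρ.Quotient) = (d' : ρ.Quotient) := by
      rw [← RingCon.coe_add, RingCon.eq]
      exact hdd' ρ h1 h2
    rw [← h3, ← add_assoc, hxd]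
  intro U U' hU hU' u u' hu hu' h
  rw [regCongruenceGen_iff]
  intro ρ h1 h2
  exact h1 U U' hU hU' u u' hu hu'
    ((key ρ h1 h2 U U' h.subset).antisymm (key ρ h1 h2 U' U h.symm.subset))

theorem regCongruenceGen_of_rel [KleeneAlgebra D] {R : D → D → Prop} {x y : D} (h : R x y) :
    regCongruenceGen R x y :=
  regCongruenceGen_iff.2 fun _ _ h2 => h2 x y h

/-- The idempotent semiring structure of the quotient by a semiring congruence. -/
abbrev quotIdemSemiring [KleeneAlgebra D] (ρ : RingCon D) : IdemSemiring ρ.Quotient :=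
  IdemSemiring.ofSemiring fun x => by
    induction x using Quotient.inductionOn' with
    | h a => exact (RingCon.eq ρ).2 (by rw [show (fun x1 x2 : D => x1 + x2) a a = a from add_idem a]; exact ρ.refl a)

/-- Passing to the quotient by a regular congruence preserves suprema of regular sets. -/
theorem isLUB_quot [KleeneAlgebra D] {ρ : RingCon D} (hρ : IsRegCongruence ρ) {U : Set D}
    (hU : IsRegSet U) {u : D} (hu : IsLUB U u) :
    letI := quotIdemSemiring ρ
    IsLUB ((fun x : D => (x : ρ.Quotient)) '' U) (u : ρ.Quotient) := by
  letI := quotIdemSemiring ρ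
  constructor
  · rintro _ ⟨x, hx, rfl⟩
    change (x : ρ.Quotient) + (u : ρ.Quotient) = u
    rw [← RingCon.coe_add, (hu.1 hx).add_eq_right]
  · intro e he
    induction e using Quotient.inductionOn' with
    | h e =>
      change (u : ρ.Quotient) + (e : ρ.Quotient) = (e : ρ.Quotient)
      rw [← RingCon.coe_add, RingCon.eq]
      refine hρ (U ∪ {e}) {e} (hU.union (IsRegSet.singleton e)) (IsRegSet.singleton e) _ _ ?_
        isLUB_singleton ?_
      · rw [add_eq_sup]
        exact hu.union isLUB_singleton
      · ext x
        constructor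
        · rintro ⟨d, hd | rfl, hxd⟩
          · refine ⟨e, rfl, ?_⟩
            have h : (d : ρ.Quotient) + (e : ρ.Quotient) = (e : ρ.Quotient) := he ⟨d, hd, rfl⟩
            rw [← h, ← add_assoc, hxd]
          · exact ⟨d, rfl, hxd⟩
        · rintro ⟨d, hd, hxd⟩
          exact ⟨d, Or.inr hd, hxd⟩

theorem isRegSet_mul_star_mul [KleeneAlgebra D] (a c b : D) :
    IsRegSet (Set.range fun n : ℕ => a * c ^ n * b) := by
  have h := ((IsRegSet.singleton a).mul (IsRegSet.singleton c).star).mul (IsRegSet.singleton b)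
  convert h using 1
  simp only [Set.singleton_pow, Set.mul_iUnion, Set.iUnion_mul, Set.singleton_mul_singleton]
  ext x
  simp [eq_comm]

/-- A regular congruence is compatible with the star operation. -/
theorem IsRegCongruence.kstar [KleeneAlgebra D] [StarContinuous D] {ρ : RingCon D}
    (hρ : IsRegCongruence ρ) {a b : D} (hab : ρ a b) :
    ρ (KStar.kstar a) (KStar.kstar b) := by
  have hreg := fun c : D => isRegSet_mul_star_mul 1 c 1
  have hlub := fun c : D => StarContinuous.isLUB_mul_kstar_mul 1 c 1
  simp only [one_mul, mul_one] at hreg hlub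
  have hq : (a : ρ.Quotient) = b := (RingCon.eq ρ).2 hab
  refine hρ _ _ (hreg a) (hreg b) _ _ (hlub a) (hlub b) ?_
  ext x
  simp only [quotDownset, Set.exists_range_iff, Set.mem_ofPred_eq, RingCon.coe_pow, hq]

/-- The star operation of the quotient: the class of `a` is sent to the class of `a∗`. -/
def quotStar [KleeneAlgebra D] [StarContinuous D] (ρ : RingCon D) (hρ : IsRegCongruence ρ) :
    ρ.Quotient → ρ.Quotient :=
  Quotient.map' (s₁ := ρ.toSetoid) (s₂ := ρ.toSetoid) KStar.kstar fun _ _ h => hρ.kstar h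

theorem isLUB_quotStar [KleeneAlgebra D] [StarContinuous D] (ρ : RingCon D)
    (hρ : IsRegCongruence ρ) (a c b : ρ.Quotient) :
    letI := quotIdemSemiring ρ
    IsLUB (Set.range fun n : ℕ => a * c ^ n * b) (a * quotStar ρ hρ c * b) := by
  induction a using Quotient.inductionOn' with
  | h a =>
  induction c using Quotient.inductionOn' with
  | h c =>
  induction b using Quotient.inductionOn' with
  | h b =>
  have h := isLUB_quot hρ (isRegSet_mul_star_mul a c b)
    (StarContinuous.isLUB_mul_kstar_mul a c b)
  rw [← Set.range_comp] at h
  exact h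

/-- The quotient of a star-continuous Kleene algebra by a regular congruence is a Kleene
algebra. -/
abbrev quotKleeneAlgebra [KleeneAlgebra D] [StarContinuous D] (ρ : RingCon D)
    (hρ : IsRegCongruence ρ) : KleeneAlgebra ρ.Quotient :=
  letI := quotIdemSemiring ρ
  kleeneAlgebraOfStarContinuous (quotStar ρ hρ) (isLUB_quotStar ρ hρ)

theorem quotStarContinuous [KleeneAlgebra D] [StarContinuous D] (ρ : RingCon D)
    (hρ : IsRegCongruence ρ) :
    letI := quotKleeneAlgebra ρ hρ
    StarContinuous ρ.Quotient :=
  letI := quotKleeneAlgebra ρ hρ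
  ⟨isLUB_quotStar ρ hρ⟩

end Congruences

/-! ## The polycyclic Kleene algebras -/

/-- The alphabet of `m` bracket pairs. -/
inductive BracketLetter (m : ℕ) : Type
  | opening (i : Fin m)
  | closing (i : Fin m)

/-- The bracket `x`, as the one-word language `{x}`. -/
def bracketLang {m : ℕ} (x : BracketLetter m) : RegSet (FreeMonoid (BracketLetter m)) :=
  RegSet.single (FreeMonoid.of x)

/-- The relations `p i * q j = δ i j` between regular sets of words over the brackets. -/
inductive PolycyclicRel (m : ℕ) :
    RegSet (FreeMonoid (BracketLetter m)) → RegSet (FreeMonoid (BracketLetter m)) → Prop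
  | of (i j : Fin m) : PolycyclicRel m
      (bracketLang (BracketLetter.opening i) * bracketLang (BracketLetter.closing j)) (if i = j then 1 else 0)

/-- The polycyclic Kleene algebra on `m` bracket pairs: the quotient of the regular sets of
words over the brackets by the least regular congruence containing the relations
`p i * q j = δ i j`. -/
def Polycyclic (m : ℕ) : Type := (regCongruenceGen (PolycyclicRel m)).Quotient

namespace Polycyclic

instance instKleeneAlgebra (m : ℕ) : KleeneAlgebra (Polycyclic m) :=
  quotKleeneAlgebra _ (isRegCongruence_regCongruenceGen (PolycyclicRel m))

instance instStarContinuous (m : ℕ) : StarContinuous (Polycyclic m) :=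
  quotStarContinuous _ (isRegCongruence_regCongruenceGen (PolycyclicRel m))

/-- The opening bracket `p i`. -/
def opening {m : ℕ} (i : Fin m) : Polycyclic m :=
  (regCongruenceGen (PolycyclicRel m)).toQuotient (bracketLang (BracketLetter.opening i))

/-- The closing bracket `q i`. -/
def closing {m : ℕ} (i : Fin m) : Polycyclic m :=
  (regCongruenceGen (PolycyclicRel m)).toQuotient (bracketLang (BracketLetter.closing i))

end Polycyclic

/-! ## Tensor products -/

section TensorProducts

variable (K₁ K₂ : Type*) [KleeneAlgebra K₁] [KleeneAlgebra K₂]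

/-- The tensor product equations `A × B = {(∑ A, ∑ B)}` between regular subsets of the product
of the multiplicative monoids of `K₁` and `K₂`, where `∑` is the least upper bound. -/
inductive TensorRel : RegSet (K₁ × K₂) → RegSet (K₁ × K₂) → Prop
  | of {A : Set K₁} {B : Set K₂} (hA : IsRegSet A) (hB : IsRegSet B) {a : K₁} {b : K₂}
      (ha : IsLUB A a) (hb : IsLUB B b) :
      TensorRel ⟨A ×ˢ B, hA.prod hB⟩ (RegSet.single (a, b))

/-- The tensor product of star-continuous Kleene algebras: the quotient of the regular subsets
of the product of the multiplicative monoids by the least regular congruence containing the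
tensor product equations. -/
def KleeneTensor : Type _ := (regCongruenceGen (TensorRel K₁ K₂)).Quotient

namespace KleeneTensor

instance instKleeneAlgebra : KleeneAlgebra (KleeneTensor K₁ K₂) :=
  quotKleeneAlgebra _ (isRegCongruence_regCongruenceGen (TensorRel K₁ K₂))

instance instStarContinuous : StarContinuous (KleeneTensor K₁ K₂) :=
  quotStarContinuous _ (isRegCongruence_regCongruenceGen (TensorRel K₁ K₂))

variable {K₁ K₂}

/-- The canonical map `a ↦ a ⊗ 1`, the class of `{(a, 1)}`. -/
def inl (a : K₁) : KleeneTensor K₁ K₂ :=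
  (regCongruenceGen (TensorRel K₁ K₂)).toQuotient (RegSet.single (a, 1))

/-- The canonical map `b ↦ 1 ⊗ b`, the class of `{(1, b)}`. -/
def inr (b : K₂) : KleeneTensor K₁ K₂ :=
  (regCongruenceGen (TensorRel K₁ K₂)).toQuotient (RegSet.single (1, b))

end KleeneTensor

end TensorProducts

/-! ## Iteration of matrices -/

section MatrixStar

variable {T : Type*} [KleeneAlgebra T]

/-- The block formula: the star of the matrix with blocks `A`, `B`, `C`, `D`, in terms of the
star `Ds` of `D` and the star `Fs` of `A + B * Ds * C`. -/
def blockStar {m n : Type} [Fintype m] [Fintype n] (B : Matrix m n T) (C : Matrix n m T)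
    (Fs : Matrix m m T) (Ds : Matrix n n T) : Matrix (m ⊕ n) (m ⊕ n) T :=
  Matrix.fromBlocks Fs (Fs * B * Ds) (Ds * C * Fs) (Ds * C * Fs * B * Ds + Ds)

/-- The iteration of a square matrix over a Kleene algebra, by recursion on the dimension,
splitting off the last row and the last column. -/
def matStar : (n : ℕ) → Matrix (Fin n) (Fin n) T → Matrix (Fin n) (Fin n) T
  | 0, M => M
  | n + 1, M =>
    let N : Matrix (Fin n ⊕ Fin 1) (Fin n ⊕ Fin 1) T :=
      M.submatrix finSumFinEquiv finSumFinEquiv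
    let Ds : Matrix (Fin 1) (Fin 1) T := Matrix.of fun i j => KStar.kstar (N.toBlocks₂₂ i j)
    let Fs : Matrix (Fin n) (Fin n) T :=
      matStar n (N.toBlocks₁₁ + N.toBlocks₁₂ * Ds * N.toBlocks₂₁)
    (blockStar N.toBlocks₁₂ N.toBlocks₂₁ Fs Ds).submatrix
      finSumFinEquiv.symm finSumFinEquiv.symm

theorem matStar_one (M : Matrix (Fin 1) (Fin 1) T) (i j : Fin 1) :
    matStar 1 M i j = KStar.kstar (M i j) := by
  have h : (finSumFinEquiv (m := 0) (n := 1)).symm 0 = Sum.inr 0 := rfl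
  have h' : (finSumFinEquiv (m := 0) (n := 1)) (Sum.inr 0) = 0 := rfl
  fin_cases i
  fin_cases j
  simp [matStar, blockStar, Matrix.submatrix, h, Matrix.toBlocks₂₂, h']

/-- `S *ᵥ v` is the least solution `x` of `M *ᵥ x + v ≤ x`, for every vector `v`. -/
def IsLeastStar {n : Type} [Fintype n] (M S : Matrix n n T) : Prop :=
  (∀ v : n → T, M.mulVec (S.mulVec v) + v ≤ S.mulVec v) ∧
    ∀ x v : n → T, M.mulVec x + v ≤ x → S.mulVec v ≤ x

theorem mulVec_mono_right {m n : Type} [Fintype n] (M : Matrix m n T) {v w : n → T}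
    (h : v ≤ w) : M.mulVec v ≤ M.mulVec w := fun i =>
  Finset.sum_le_sum fun j _ => mul_le_mul_right (h j) (M i j)

theorem IsLeastStar.unique {n : Type} [Fintype n] {M S S' : Matrix n n T}
    (h : IsLeastStar M S) (h' : IsLeastStar M S') : S = S' := by
  classical
  refine Matrix.ext_of_mulVec_single fun i => le_antisymm ?_ ?_
  · exact h.2 _ _ (h'.1 _)
  · exact h'.2 _ _ (h.1 _)

theorem IsLeastStar.blockStar {m n : Type} [Fintype m] [Fintype n]
    {A : Matrix m m T} {B : Matrix m n T} {C : Matrix n m T} {D : Matrix n n T}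
    {Fs : Matrix m m T} {Ds : Matrix n n T}
    (hD : IsLeastStar D Ds) (hF : IsLeastStar (A + B * Ds * C) Fs) :
    IsLeastStar (Matrix.fromBlocks A B C D) (blockStar B C Fs Ds) := by
  have e1 : ∀ (s : m → T) (t : n → T), (_root_.blockStar B C Fs Ds).mulVec (Sum.elim s t) =
      Sum.elim (Fs.mulVec (s + B.mulVec (Ds.mulVec t)))
        (Ds.mulVec (C.mulVec (Fs.mulVec (s + B.mulVec (Ds.mulVec t))) + t)) := by
    intro s t
    simp only [_root_.blockStar, Matrix.fromBlocks_mulVec, Sum.elim_comp_inl, Sum.elim_comp_inr,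
      Matrix.mulVec_add, Matrix.add_mulVec, Matrix.mulVec_mulVec, Matrix.mul_assoc, add_assoc]
  have e2 : ∀ (x : m → T), (A + B * Ds * C).mulVec x =
      A.mulVec x + B.mulVec (Ds.mulVec (C.mulVec x)) := by
    intro x
    simp only [Matrix.add_mulVec, Matrix.mulVec_mulVec, Matrix.mul_assoc]
  have e3 : ∀ v : m ⊕ n → T, ∃ s t, v = Sum.elim s t := fun v =>
    ⟨v ∘ Sum.inl, v ∘ Sum.inr, (Sum.elim_comp_inl_inr v).symm⟩
  have e4 : ∀ (x : m → T) (y : n → T) (s : m → T) (t : n → T),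
      (Matrix.fromBlocks A B C D).mulVec (Sum.elim x y) + Sum.elim s t =
        Sum.elim (A.mulVec x + B.mulVec y + s) (C.mulVec x + D.mulVec y + t) := by
    intro x y s t
    rw [Matrix.fromBlocks_mulVec]
    simp only [Sum.elim_comp_inl, Sum.elim_comp_inr]
    ext (i | i) <;> rfl
  constructor
  · intro v
    obtain ⟨s, t, rfl⟩ := e3 v
    rw [e1, e4, Sum.elim_le_elim_iff]
    set x := Fs.mulVec (s + B.mulVec (Ds.mulVec t)) with hx
    constructor
    · have h := hF.1 (s + B.mulVec (Ds.mulVec t))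
      rw [← hx, e2] at h
      refine le_trans (le_of_eq ?_) h
      simp only [Matrix.mulVec_add]
      abel
    · refine le_trans (le_of_eq ?_) (hD.1 (C.mulVec x + t))
      abel
  · intro w v h
    obtain ⟨s, t, rfl⟩ := e3 v
    obtain ⟨x, y, rfl⟩ := e3 w
    rw [e4, Sum.elim_le_elim_iff] at h
    rw [e1, Sum.elim_le_elim_iff]
    have hy : Ds.mulVec (C.mulVec x + t) ≤ y :=
      hD.2 _ _ (le_trans (le_of_eq (by abel)) h.2)
    have hx : Fs.mulVec (s + B.mulVec (Ds.mulVec t)) ≤ x := by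
      refine hF.2 _ _ (le_trans ?_ h.1)
      have h1 := mulVec_mono_right B hy
      rw [e2]
      calc _ = A.mulVec x + B.mulVec (Ds.mulVec (C.mulVec x + t)) + s := by
              simp only [Matrix.mulVec_add]; abel
        _ ≤ _ := add_le_add_left (add_le_add_right h1 _) _
    exact ⟨hx, le_trans (mulVec_mono_right Ds (add_le_add_left (mulVec_mono_right C hx) t)) hy⟩

theorem IsLeastStar.submatrix {m n : Type} [Fintype m] [Fintype n] (e : m ≃ n)
    {M S : Matrix n n T} (h : IsLeastStar M S) :
    IsLeastStar (M.submatrix e e) (S.submatrix e e) := by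
  have key : ∀ (N : Matrix n n T) (v : m → T),
      (N.submatrix e e).mulVec v = N.mulVec (v ∘ e.symm) ∘ e := by
    intro N v
    exact Matrix.submatrix_mulVec_equiv N v e e
  constructor
  · intro v i
    have := h.1 (v ∘ e.symm) (e i)
    simpa [key, Function.comp_assoc] using this
  · intro x v hx i
    rw [key]
    have := h.2 (x ∘ e.symm) (v ∘ e.symm) (fun j => by
      have := hx (e.symm j)
      simpa [key] using this) (e i)
    simpa using this

theorem isLeastStar_matStar : ∀ (n : ℕ) (M : Matrix (Fin n) (Fin n) T),
    IsLeastStar M (matStar n M)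
  | 0, _ => ⟨fun _ i => i.elim0, fun _ _ _ i => i.elim0⟩
  | n + 1, M => by
    have hD : ∀ D : Matrix (Fin 1) (Fin 1) T,
        IsLeastStar D (Matrix.of fun i j => KStar.kstar (D i j)) := by
      intro D
      constructor
      · intro v i
        have h : D 0 0 * (KStar.kstar (D 0 0) * v 0) + v 0 ≤ KStar.kstar (D 0 0) * v 0 := by
          refine add_le ?_ (le_mul_of_one_le_left' one_le_kstar)
          rw [← mul_assoc]
          exact mul_le_mul_left mul_kstar_le_kstar _
        fin_cases i
        simpa [Matrix.mulVec, dotProduct, Matrix.mul_apply, mul_assoc] using h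
      · intro x v h i
        have h0 := h 0
        simp only [Matrix.mulVec, dotProduct, Finset.univ_unique, Fin.default_eq_zero,
          Finset.sum_singleton, Pi.add_apply, add_le_iff] at h0
        fin_cases i
        simpa [Matrix.mulVec, dotProduct] using kstar_mul_le h0.2 h0.1
    have h := IsLeastStar.submatrix (finSumFinEquiv (m := n) (n := 1)).symm
      (IsLeastStar.blockStar (hD _) (isLeastStar_matStar n
        ((M.submatrix finSumFinEquiv finSumFinEquiv).toBlocks₁₁ +
          (M.submatrix finSumFinEquiv finSumFinEquiv).toBlocks₁₂ *
          (Matrix.of fun i j => KStar.kstar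
            ((M.submatrix finSumFinEquiv finSumFinEquiv).toBlocks₂₂ i j)) *
          (M.submatrix finSumFinEquiv finSumFinEquiv).toBlocks₂₁)))
    rw [Matrix.fromBlocks_toBlocks] at h
    simpa [matStar] using h

/-- The iteration of a matrix can be computed by the block formula from any splitting. -/
theorem matStar_split (m n : ℕ) (A : Matrix (Fin m) (Fin m) T) (B : Matrix (Fin m) (Fin n) T)
    (C : Matrix (Fin n) (Fin m) T) (D : Matrix (Fin n) (Fin n) T) :
    matStar (m + n) ((Matrix.fromBlocks A B C D).submatrix
        finSumFinEquiv.symm finSumFinEquiv.symm) =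
      (blockStar B C (matStar m (A + B * matStar n D * C)) (matStar n D)).submatrix
        finSumFinEquiv.symm finSumFinEquiv.symm :=
  (isLeastStar_matStar _ _).unique (IsLeastStar.submatrix _
    (IsLeastStar.blockStar (isLeastStar_matStar n D) (isLeastStar_matStar m _)))

/-- The embedding of the boolean Kleene algebra `{0, 1}`. -/
def boolVal (x : Bool) : T := if x then 1 else 0

/-- The value `S * A∗ * F` of the automaton with `n` states, initial states `S`, transition
matrix `A` and final states `F`. -/
def automatonValue {n : ℕ} (S : Matrix (Fin 1) (Fin n) Bool) (A : Matrix (Fin n) (Fin n) T)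
    (F : Matrix (Fin n) (Fin 1) Bool) : T :=
  ((S.map boolVal : Matrix (Fin 1) (Fin n) T) * matStar n A *
    (F.map boolVal : Matrix (Fin n) (Fin 1) T)) 0 0

end MatrixStar

/-! ## Recognizable elements of a Kleene algebra -/

section Recognizable

open Matrix

variable {T : Type*} [KleeneAlgebra T]

/-! This is Kleene's theorem on finite automata, relative to a set of labels. In any Kleene algebra,
if a label predicate `P` holds of 0 and 1, the values of finite automata with labels in `P` include
all labels (`of_label`) and are closed under sum, product and star (`add`, `mul`, `kstar`). They
therefore exhaust any algebra generated by such labels.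

The automaton constructions join automata along block matrices, so `Recognizable` allows any finite
index type and replaces `matStar` by any matrix satisfying `IsLeastStar`. The block formula computes
the star of each construction. Since least stars are unique, the result can be reindexed by `Fin n`
at the end (`exists_automatonValue`).

It remains to see that `K ⊗ C₂'` is generated by `K` and the four brackets. Regular sets are built
from singletons, and `(a, b) = (a, 1)(1, b)`, so the tensor product is generated by its two factors.
The algebra `C₂'` is generated by brackets because words are. The two facts combine because `inr`
preserves 0, 1, sum, product and star. For 0, sum and star this comes from the tensor equations for
`{1} × B`. -/

@[simp]
theorem boolVal_true : (boolVal true : T) = 1 := rfl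

@[simp]
theorem boolVal_false : (boolVal false : T) = 0 := rfl

theorem isLeastStar_one (M : Matrix (Fin 1) (Fin 1) T) :
    IsLeastStar M (Matrix.of fun i j => KStar.kstar (M i j)) := by
  have h := isLeastStar_matStar 1 M
  have e : matStar 1 M = Matrix.of fun i j => KStar.kstar (M i j) := by
    ext i j
    exact matStar_one M i j
  rwa [e] at h

/-- `φ` is the value of a finite automaton all of whose transition labels satisfy `P`. -/
def Recognizable (P : T → Prop) (φ : T) : Prop :=
  ∃ (ι : Type) (_ : Fintype ι) (_ : Nonempty ι) (s f : ι → Bool) (A A' : Matrix ι ι T),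
    IsLeastStar A A' ∧ (∀ i j, P (A i j)) ∧
      φ = (fun i => boolVal (s i)) ⬝ᵥ (A' *ᵥ fun i => boolVal (f i))

/-! ### Closure of automaton values under the Kleene operations -/

namespace Recognizable

variable {P : T → Prop}

theorem boolVal_mul_boolVal (h0 : P 0) (h1 : P 1) (x y : Bool) :
    P (boolVal x * boolVal y) := by
  cases x <;> cases y <;> simpa

/-- Disjoint union of automata: the star of a block diagonal matrix is block diagonal. -/
theorem add (h0 : P 0) {φ ψ : T} (hφ : Recognizable P φ) (hψ : Recognizable P ψ) :
    Recognizable P (φ + ψ) := by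
  obtain ⟨ι, _, _, s, f, A, A', hA, hP, rfl⟩ := hφ
  obtain ⟨κ, _, _, t, g, B, B', hB, hQ, rfl⟩ := hψ
  refine ⟨ι ⊕ κ, inferInstance, inferInstance, Sum.elim s t, Sum.elim f g, _, _,
    IsLeastStar.blockStar (A := A) (B := 0) (C := 0) hB (by simpa using hA), ?_, ?_⟩
  · rintro (i | i) (j | j) <;> simp [*]
  · simp [blockStar, Matrix.fromBlocks_mulVec, Function.comp_def, dotProduct]

/-- Every final state of the first automaton is joined to every initial state of the second by an
edge labelled 1. The connecting block is the outer product of `f` and `t`, and the upper right block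
of the star is `A' f t B'`. -/
theorem mul (h0 : P 0) (h1 : P 1) {φ ψ : T} (hφ : Recognizable P φ) (hψ : Recognizable P ψ) :
    Recognizable P (φ * ψ) := by
  obtain ⟨ι, _, _, s, f, A, A', hA, hP, rfl⟩ := hφ
  obtain ⟨κ, _, _, t, g, B, B', hB, hQ, rfl⟩ := hψ
  refine ⟨ι ⊕ κ, inferInstance, inferInstance, Sum.elim s fun _ => false,
    Sum.elim (fun _ => false) g, _, _,
    IsLeastStar.blockStar (A := A)
      (B := Matrix.vecMulVec (fun i => boolVal (f i)) fun j => boolVal (t j)) (C := 0) hB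
      (by simpa using hA), ?_, ?_⟩
  · rintro (i | i) (j | j) <;>
      simp [*, Matrix.vecMulVec_apply, boolVal_mul_boolVal h0 h1]
  -- Multiplication is not commutative, so the factor `t B' g` is carried inwards from the right:
  -- `(s A' f)(t B' g) = s A' ((f t)(B' g))`.
  · have e : ∀ (v w : ι → T) (x : T), v ⬝ᵥ (fun i => w i * x) = v ⬝ᵥ w * x := fun v w x => by
      simp [dotProduct, Finset.sum_mul, mul_assoc]
    have e' : ∀ (M : Matrix ι ι T) (w : ι → T) (x : T),
        M *ᵥ (fun i => w i * x) = fun i => (M *ᵥ w) i * x := fun M w x => by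
      ext i
      exact e _ _ _
    have e'' : ∀ (v : ι → T) (w u : κ → T), Matrix.vecMulVec v w *ᵥ u =
        fun i => v i * (w ⬝ᵥ u) := fun v w u => by
      ext i
      simp [Matrix.mulVec, dotProduct, Matrix.vecMulVec_apply, Finset.mul_sum, mul_assoc]
    rw [← e, ← e', ← e'']
    simp [blockStar, Matrix.fromBlocks_mulVec, Function.comp_def, dotProduct,
      Matrix.mulVec_mulVec, Matrix.mul_assoc, Pi.zero_def.symm]

/-- One new state, both initial and final, has edges labelled 1 to the old initial states and from
the old final states. Eliminating the old states leaves a loop of weight `0 + s A' f = φ` at the new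
state, so the corner entry of the star is the star of `φ`. -/
theorem kstar (h0 : P 0) (h1 : P 1) {φ : T} (hφ : Recognizable P φ) :
    Recognizable P (KStar.kstar φ) := by
  obtain ⟨ι, _, _, s, f, A, A', hA, hP, rfl⟩ := hφ
  refine ⟨Fin 1 ⊕ ι, inferInstance, inferInstance, Sum.elim (fun _ => true) fun _ => false,
    Sum.elim (fun _ => true) fun _ => false, _, _,
    IsLeastStar.blockStar (A := 0) (B := Matrix.of fun _ j => boolVal (s j))
      (C := Matrix.of fun i _ => boolVal (f i)) hA (isLeastStar_one _), ?_, ?_⟩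
  · have h : ∀ x, P (boolVal x) := by
      intro x
      cases x <;> simpa
    rintro (i | i) (j | j) <;> simp [*]
  · simp [blockStar, dotProduct, Matrix.mul_assoc, Matrix.mulVec, Matrix.mul_apply]

/-- Two states and one edge labelled `a`: both diagonal blocks are 0 with star 1, so the
off-diagonal entry of the star is `1 * a * 1`. -/
theorem of_label (h0 : P 0) {a : T} (ha : P a) : Recognizable P a := by
  have hz : IsLeastStar (0 : Matrix (Fin 1) (Fin 1) T) 1 := by
    constructor
    · intro v; simp
    · intro x v h; simpa using h
  refine ⟨Fin 1 ⊕ Fin 1, inferInstance, inferInstance, Sum.elim (fun _ => true) fun _ => false,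
    Sum.elim (fun _ => false) fun _ => true, _, _,
    IsLeastStar.blockStar (A := 0) (B := Matrix.of fun _ _ => a) (C := 0) hz (by simpa using hz),
    ?_, ?_⟩
  · rintro (i | i) (j | j) <;> simp [*]
  · simp [blockStar, dotProduct, Matrix.mulVec]

/-- Recognizable elements are the values of automata with states `0, …, n - 1`. -/
theorem exists_automatonValue {φ : T} (hφ : Recognizable P φ) :
    ∃ (n : ℕ) (S : Matrix (Fin 1) (Fin n) Bool) (F : Matrix (Fin n) (Fin 1) Bool)
      (A : Matrix (Fin n) (Fin n) T), 0 < n ∧ (∀ i j, P (A i j)) ∧ φ = automatonValue S A F := by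
  obtain ⟨ι, _, _, s, f, A, A', hA, hP, rfl⟩ := hφ
  let e := (Fintype.equivFin ι).symm
  refine ⟨Fintype.card ι, Matrix.of fun _ j => s (e j), Matrix.of fun i _ => f (e i),
    A.submatrix e e, Fintype.card_pos, fun i j => hP _ _, ?_⟩
  -- Uniqueness of least stars identifies `matStar` of the reindexed matrix with the reindexed `A'`.
  rw [automatonValue, (isLeastStar_matStar _ _).unique (hA.submatrix e), Matrix.mul_assoc]
  simp only [dotProduct, Matrix.mulVec, Matrix.mul_apply, Matrix.map_apply, Matrix.of_apply,
    Matrix.submatrix_apply]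
  rw [← e.sum_comp]
  exact Finset.sum_congr rfl fun i _ => by rw [← e.sum_comp]

end Recognizable

end Recognizable

/-! ## Generators of the tensor product -/

/-- An induction principle for quotients of algebras of regular sets. -/
theorem regSet_quotient_induction {M : Type*} [Monoid M] {ρ : RingCon (RegSet M)}
    (hρ : IsRegCongruence ρ) {motive : ρ.Quotient → Prop}
    (zero : motive 0)
    (single : ∀ m : M, motive (ρ.toQuotient (RegSet.single m)))
    (add : ∀ x y, motive x → motive y → motive (x + y))
    (mul : ∀ x y, motive x → motive y → motive (x * y))
    (star : ∀ x, motive x → motive (quotStar ρ hρ x)) (x : ρ.Quotient) : motive x := by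
  induction x using Quotient.inductionOn' with
  | h A =>
  obtain ⟨A, hA⟩ := A
  induction hA with
  -- All cases hold by definition, since the quotient operations act on representatives.
  | empty => exact zero
  | singleton m => exact single m
  | union _ _ h1 h2 => exact add _ _ h1 h2
  | mul _ _ h1 h2 => exact mul _ _ h1 h2
  | star _ h => exact star _ h

theorem RegSet.single_mul_single {M : Type*} [Monoid M] (x y : M) :
    RegSet.single x * RegSet.single y = RegSet.single (x * y) :=
  Subtype.ext Set.singleton_mul_singleton

theorem RegSet.val_single {M : Type*} [Monoid M] (x : M) : (RegSet.single x).1 = {x} := rfl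

namespace KleeneTensor

variable {K₁ K₂ : Type*} [KleeneAlgebra K₁] [KleeneAlgebra K₂]

theorem toQuotient_single (a : K₁) (b : K₂) :
    (regCongruenceGen (TensorRel K₁ K₂)).toQuotient (RegSet.single (a, b)) =
      (inl a * inr b : KleeneTensor K₁ K₂) := by
  have h := RegSet.single_mul_single (a, (1 : K₂)) ((1 : K₁), b)
  rw [Prod.mk_mul_mk, mul_one, one_mul] at h
  rw [← h]
  rfl

theorem toQuotient_prod {A : Set K₁} {B : Set K₂} (hA : IsRegSet A) (hB : IsRegSet B)
    {a : K₁} {b : K₂} (ha : IsLUB A a) (hb : IsLUB B b) :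
    (regCongruenceGen (TensorRel K₁ K₂)).toQuotient ⟨A ×ˢ B, hA.prod hB⟩ =
      (regCongruenceGen (TensorRel K₁ K₂)).toQuotient (RegSet.single (a, b)) :=
  (RingCon.eq _).2 (regCongruenceGen_of_rel (TensorRel.of hA hB ha hb))

/-- The tensor equation with first factor `{1}`. Taking `B` to be `∅`, `{b} ∪ {c}` or the set of
powers of `b` shows that `inr` preserves 0, sums and stars; `C` is then the matching expression in
regular sets. -/
theorem inr_eq_of_isLUB {B : Set K₂} (hB : IsRegSet B) {b : K₂} (hb : IsLUB B b)
    (C : RegSet (K₁ × K₂)) (hC : C.1 = {1} ×ˢ B) :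
    (inr b : KleeneTensor K₁ K₂) = (regCongruenceGen (TensorRel K₁ K₂)).toQuotient C := by
  rw [show C = ⟨{1} ×ˢ B, (IsRegSet.singleton 1).prod hB⟩ from Subtype.ext hC]
  exact (toQuotient_prod (IsRegSet.singleton 1) hB isLUB_singleton hb).symm

theorem isLUB_empty_zero {K : Type*} [KleeneAlgebra K] : IsLUB (∅ : Set K) 0 := by
  rw [isLUB_empty_iff]
  exact fun _ => zero_le

theorem inl_zero : (inl 0 : KleeneTensor K₁ K₂) = 0 := by
  refine (toQuotient_prod IsRegSet.empty (IsRegSet.singleton 1) isLUB_empty_zero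
    isLUB_singleton).symm.trans (congrArg _ (Subtype.ext ?_))
  exact Set.empty_prod

theorem inr_zero : (inr 0 : KleeneTensor K₁ K₂) = 0 :=
  inr_eq_of_isLUB IsRegSet.empty isLUB_empty_zero 0 Set.prod_empty.symm

theorem inr_mul (b c : K₂) : (inr (b * c) : KleeneTensor K₁ K₂) = inr b * inr c := by
  have h := RegSet.single_mul_single ((1 : K₁), b) ((1 : K₁), c)
  rw [Prod.mk_mul_mk, mul_one] at h
  rw [inr, ← h]
  rfl

theorem inr_add (b c : K₂) : (inr (b + c) : KleeneTensor K₁ K₂) = inr b + inr c := by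
  refine inr_eq_of_isLUB ((IsRegSet.singleton b).union (IsRegSet.singleton c)) ?_
    (RegSet.single (1, b) + RegSet.single (1, c)) ?_
  · rw [add_eq_sup]
    exact isLUB_singleton.union isLUB_singleton
  · rw [RegSet.val_add, RegSet.val_single, RegSet.val_single, Set.prod_union,
      Set.singleton_prod_singleton, Set.singleton_prod_singleton]

/-- By star-continuity the star of `b` is the supremum of the regular set of powers of `b`, and
`{1}` times that set is the iteration of `{(1, b)}`. -/
theorem inr_kstar [StarContinuous K₂] (b : K₂) :
    (inr (KStar.kstar b) : KleeneTensor K₁ K₂) = KStar.kstar (inr b) := by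
  have h := StarContinuous.isLUB_mul_kstar_mul 1 b 1
  have hr := isRegSet_mul_star_mul 1 b 1
  simp only [one_mul, mul_one] at h hr
  refine inr_eq_of_isLUB hr h (RegSet.iter (RegSet.single (1, b))) ?_
  rw [RegSet.val_iter, RegSet.val_single]
  ext ⟨x, y⟩
  simp [eq_comm]

/-- The tensor product is generated, as a Kleene algebra, by the images of its factors. -/
theorem induction {motive : KleeneTensor K₁ K₂ → Prop}
    (inl : ∀ a, motive (inl a)) (inr : ∀ b, motive (inr b))
    (add : ∀ x y, motive x → motive y → motive (x + y))
    (mul : ∀ x y, motive x → motive y → motive (x * y))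
    (star : ∀ x, motive x → motive (KStar.kstar x)) (x : KleeneTensor K₁ K₂) : motive x := by
  refine regSet_quotient_induction (isRegCongruence_regCongruenceGen (TensorRel K₁ K₂))
    (motive := motive) ?_ ?_ add mul star x
  -- The empty set needs no hypothesis of its own, its class being the image of `0`.
  · exact inl_zero (K₁ := K₁) (K₂ := K₂) ▸ inl 0
  · rintro ⟨a, b⟩
    rw [toQuotient_single]
    exact mul _ _ (inl a) (inr b)

end KleeneTensor

/-- The polycyclic Kleene algebra is generated, as a Kleene algebra, by the brackets. -/
theorem Polycyclic.induction {m : ℕ} {motive : Polycyclic m → Prop}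
    (zero : motive 0) (one : motive 1)
    (opening : ∀ i, motive (opening i)) (closing : ∀ i, motive (closing i))
    (add : ∀ x y, motive x → motive y → motive (x + y))
    (mul : ∀ x y, motive x → motive y → motive (x * y))
    (star : ∀ x, motive x → motive (KStar.kstar x)) (x : Polycyclic m) : motive x := by
  refine regSet_quotient_induction (isRegCongruence_regCongruenceGen (PolycyclicRel m))
    (motive := motive) zero ?_ add mul star x
  intro w
  -- A one-word language is a product of one-letter languages.
  induction w using FreeMonoid.inductionOn' with
  | one => exact one
  | of_mul x w ih =>
    rw [← RegSet.single_mul_single]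
    refine mul ((regCongruenceGen (PolycyclicRel m)).toQuotient (bracketLang x)) _ ?_ ih
    cases x with
    | opening i => exact opening i
    | closing i => exact closing i

/-! ### Bracket labels and the normal form -/

/-- The transition labels of bracket automata: sums `u + x + v` of an opening bracket or `0`, an
element of `K`, and a closing bracket or `0`. -/
def IsBracketLabel {K : Type*} [KleeneAlgebra K] (t : KleeneTensor K (Polycyclic 2)) : Prop :=
  ∃ u v : KleeneTensor K (Polycyclic 2), ∃ x : K,
    u ∈ ({0, KleeneTensor.inr (Polycyclic.opening 0),
      KleeneTensor.inr (Polycyclic.opening 1)} : Set (KleeneTensor K (Polycyclic 2))) ∧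
    v ∈ ({0, KleeneTensor.inr (Polycyclic.closing 0),
      KleeneTensor.inr (Polycyclic.closing 1)} : Set (KleeneTensor K (Polycyclic 2))) ∧
    t = u + KleeneTensor.inl x + v

theorem isBracketLabel_inl {K : Type*} [KleeneAlgebra K] (x : K) :
    IsBracketLabel (KleeneTensor.inl x) :=
  ⟨0, 0, x, by simp, by simp, by simp⟩

theorem isBracketLabel_opening {K : Type*} [KleeneAlgebra K] (i : Fin 2) :
    IsBracketLabel (KleeneTensor.inr (K₁ := K) (Polycyclic.opening i)) :=
  ⟨KleeneTensor.inr (Polycyclic.opening i), 0, 0, by fin_cases i <;> simp, by simp, by simp [KleeneTensor.inl_zero]⟩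

theorem isBracketLabel_closing {K : Type*} [KleeneAlgebra K] (i : Fin 2) :
    IsBracketLabel (KleeneTensor.inr (K₁ := K) (Polycyclic.closing i)) :=
  ⟨0, KleeneTensor.inr (Polycyclic.closing i), 0, by simp, by fin_cases i <;> simp, by simp [KleeneTensor.inl_zero]⟩

/-- Two nested inductions: over the tensor product, where elements of `K` are already labels, and
for the second factor over `C₂'`, transported along `inr` until only brackets remain. -/
theorem recognizable_isBracketLabel {K : Type*} [KleeneAlgebra K]
    (φ : KleeneTensor K (Polycyclic 2)) : Recognizable IsBracketLabel φ := by
  have h0 : IsBracketLabel (0 : KleeneTensor K (Polycyclic 2)) :=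
    KleeneTensor.inl_zero (K₁ := K) (K₂ := Polycyclic 2) ▸ isBracketLabel_inl 0
  -- The unit of the product monoid is `(1, 1)`, so `inl 1` is 1 by definition.
  have h1 : IsBracketLabel (1 : KleeneTensor K (Polycyclic 2)) := isBracketLabel_inl 1
  refine KleeneTensor.induction (fun x => .of_label h0 (isBracketLabel_inl x)) (fun c => ?_)
    (fun _ _ => .add h0) (fun _ _ => .mul h0 h1) (fun _ => .kstar h0 h1) φ
  refine Polycyclic.induction (motive := fun c => Recognizable IsBracketLabel
    (KleeneTensor.inr (K₁ := K) c)) ?_ ?_ (fun i => .of_label h0 (isBracketLabel_opening i))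
    (fun i => .of_label h0 (isBracketLabel_closing i)) ?_ ?_ ?_ c
  · rw [KleeneTensor.inr_zero]
    exact .of_label h0 h0
  · exact .of_label h0 h1
  · intro x y hx hy
    rw [KleeneTensor.inr_add]
    exact hx.add h0 hy
  · intro x y hx hy
    rw [KleeneTensor.inr_mul]
    exact hx.mul h0 h1 hy
  · intro x hx
    rw [KleeneTensor.inr_kstar]
    exact hx.kstar h0 h1

theorem mainTheorem5 {K : Type*} [KleeneAlgebra K] [StarContinuous K]
    (φ : KleeneTensor K (Polycyclic 2)) :
    ∃ (n : ℕ) (S : Matrix (Fin 1) (Fin n) Bool) (F : Matrix (Fin n) (Fin 1) Bool)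
      (U V : Matrix (Fin n) (Fin n) (KleeneTensor K (Polycyclic 2)))
      (X : Matrix (Fin n) (Fin n) K),
      0 < n ∧
      (∀ i j, U i j ∈ ({0, KleeneTensor.inr (Polycyclic.opening 0),
        KleeneTensor.inr (Polycyclic.opening 1)} : Set (KleeneTensor K (Polycyclic 2)))) ∧
      (∀ i j, V i j ∈ ({0, KleeneTensor.inr (Polycyclic.closing 0),
        KleeneTensor.inr (Polycyclic.closing 1)} : Set (KleeneTensor K (Polycyclic 2)))) ∧
      φ = automatonValue S (U + X.map KleeneTensor.inl + V) F := by
  obtain ⟨n, S, F, A, hn, hA, rfl⟩ := (recognizable_isBracketLabel φ).exists_automatonValue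
  -- Splitting every label into its three summands splits the transition matrix as `U + X + V`.
  choose U V X hU hV h using hA
  refine ⟨n, S, F, U, V, X, hn, hU, hV, ?_⟩
  congr 1
  ext i j
  exact h i j
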